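/- **Setting.** Let $K$ be an irreducible nonnegative real square matrix with rows and columns indexed by a finite set $E$, and let $\rho$ be its Perron root (the largest modulus of an eigenvalue of $K$). Assume $\rho>1$. Let $h$ be the index of imprimitivity of $K$, i.e. the largest integer $h\ge 1$ for which there is a partition of $E$ into nonempty sets $E_1,\dots,E_h$ such that $K_{e,f}\ne 0$ with $e\in E_i$ implies $f\in E_{i+1}$ (indices modulo $h$, so $E_{h+1}=E_1$). Fix such a partition for this $h$, and let $K_j$ be the submatrix of $K$ with rows in $E_j$ and columns in $E_{j+1}$. Let $y_1$ (a row vector) and $z_1$ (a column vector) be real left and right eigenvectors of $K_1K_2\cdots K_h$ for its Perron root, normalized by $y_1z_1=1$. For $j=1,\dots,h$ put $$y_j=\rho^{1-j}\,y_1K_1K_2\cdots K_{j-1},\qquad z_j=\rho^{j-h-1}\,K_jK_{j+1}\cdots K_hz_1 .$$ Let $Z$ be the $|E|\times h$ matrix whose $j$-th column is $z_j$ on $E_j$ and $0$ elsewhere, $Y$ the $h\times|E|$ matrix whose $j$-th row is $y_j$ on $E_j$ and $0$ elsewhere, $P$ the $h\times h$ permutation matrix with $P_{i,j}=1$ if $j\equiv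 i+1 \pmod h$ and $P_{i,j}=0$ otherwise, and $\Theta$ the $h\times h$ circulant matrix with $\Theta_{i,j}=\rho^{(j-i)\bmod h}$, where $(j-i)\bmod h\in\{0,\dots,h-1\}$. **Claim.** For every integer $r$ with $0\le r<h$, $$\lim_{q\to\infty}\frac{\rho^h-1}{\rho^{hq}-1}\sum_{i=0}^{hq+r-1}K^i=\rho^r\,Z\,P^r\,\Theta\,Y .$$ Moreover, this applies to flow matrices. Let $B$ be a connected bipartite graph, possibly with parallel edges, with finite edge set $E$ and with left nodes and right nodes, in which every right node has degree $2$, every left node has degree at least $2$ and some left node has degree at least $3$. For $e\in E$ let $\lambda(e)$ be the left node of $e$ and $\bar e$ the other edge at the right node of $e$, and let $K_{e,f}=1$ if $\lambda(\bar f)=\lambda(e)$ and $\bar f\ne e$, and $K_{e,f}=0$ otherwise. Then $K$ is irreducible and its Perron root is greater than $1$, so the limit formula holds for it. -/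

import Mathlib

open Filter Topology

namespace FlowLimit

noncomputable section

section Perron

variable {n : Type*} [Fintype n] [DecidableEq n]

/-- The largest modulus of a complex eigenvalue of a real square matrix. -/
def perronRoot (A : Matrix n n ℝ) : ℝ :=
  (spectralRadius ℂ (A.map (algebraMap ℝ ℂ))).toReal

/-- `y` (a row vector) and `z` (a column vector) are left and right eigenvectors of `A`
for its Perron root, normalized by `y z = 1`; in particular both are nonzero. -/
structure IsPerronPair (A : Matrix n n ℝ) (y z : n → ℝ) : Prop where
  left_eigen : Matrix.vecMul y A = perronRoot A • y
  right_eigen : A.mulVec z = perronRoot A • z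
  normalized : dotProduct y z = 1

end Perron

section Cyclic

variable {n : Type*}

/-- The classes `E_j = {e | c e = j}`, for `j = 0, …, h - 1`, form a partition of the index set into
`h` nonempty sets, and every nonzero entry of `K` has its row in some `E_j` and its column in the
cyclically next class `E_{j+1}` (with `E_h = E_0`). -/
structure IsCyclicPartition (K : Matrix n n ℝ) {h : ℕ} (c : n → Fin h) : Prop where
  surjective : Function.Surjective c
  step : ∀ e f, K e f ≠ 0 → (c f : ℕ) = ((c e : ℕ) + 1) % h

/-- `h` is the index of imprimitivity: the largest number of classes of a cyclic partition. -/
def IsImprimitivityIndex (K : Matrix n n ℝ) (h : ℕ) : Prop :=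
  IsGreatest {m : ℕ | 0 < m ∧ ∃ c : n → Fin m, IsCyclicPartition K c} h

/-- The elements of the class number `j` (numbering from `0`). -/
abbrev Cls {h : ℕ} (c : n → Fin h) (j : ℕ) : Type _ := {e : n // (c e : ℕ) = j}

/-- The submatrix of `K` with rows in the class `a` and columns in the class `b`. -/
def block (K : Matrix n n ℝ) {h : ℕ} (c : n → Fin h) (a b : ℕ) :
    Matrix (Cls c a) (Cls c b) ℝ :=
  K.submatrix Subtype.val Subtype.val

variable [Fintype n] [DecidableEq n]

/-- With `K_j` the block of `K` with rows in the class `j` and columns in the next class, this is the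
product `K_a K_{a+1} ⋯ K_{a+k-1}` of `k` blocks. The last factor has its columns in the class `b`;
this is used only with `b = a + k`, or with `b = 0` when `a + k = h`. The empty product is the
identity. -/
def blockProd (K : Matrix n n ℝ) {h : ℕ} (c : n → Fin h) (a : ℕ) :
    ℕ → (b : ℕ) → Matrix (Cls c a) (Cls c b) ℝ
  | 0, b => block 1 c a b
  | k + 1, b => blockProd K c a k (a + k) * block K c (a + k) b

/-- The product `K_0 K_1 ⋯ K_{h-1}` of all the blocks, a square matrix on the class `0`. -/
def cycleProd (K : Matrix n n ℝ) {h : ℕ} (c : n → Fin h) : Matrix (Cls c 0) (Cls c 0) ℝ :=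
  blockProd K c 0 h 0

/-- The row vector `y_j = ρ^{-j} y_0 K_0 ⋯ K_{j-1}` on the class `j`. -/
def leftVec (K : Matrix n n ℝ) {h : ℕ} (c : n → Fin h) (y : Cls c 0 → ℝ) (j : ℕ) :
    Cls c j → ℝ :=
  (perronRoot K ^ j)⁻¹ • Matrix.vecMul y (blockProd K c 0 j j)

/-- The column vector `z_j = ρ^{-(h-j)} K_j ⋯ K_{h-1} z_0` on the class `j < h`. -/
def rightVec (K : Matrix n n ℝ) {h : ℕ} (c : n → Fin h) (z : Cls c 0 → ℝ) (j : ℕ) :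
    Cls c j → ℝ :=
  (perronRoot K ^ (h - j))⁻¹ • (blockProd K c j (h - j) 0).mulVec z

/-- The matrix whose column `j` is `z_j` on the class `j` and zero elsewhere. -/
def matZ (K : Matrix n n ℝ) {h : ℕ} (c : n → Fin h) (z : Cls c 0 → ℝ) : Matrix n (Fin h) ℝ :=
  Matrix.of fun e j => if he : (c e : ℕ) = j then rightVec K c z j ⟨e, he⟩ else 0

/-- The matrix whose row `j` is `y_j` on the class `j` and zero elsewhere. -/
def matY (K : Matrix n n ℝ) {h : ℕ} (c : n → Fin h) (y : Cls c 0 → ℝ) : Matrix (Fin h) n ℝ :=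
  Matrix.of fun j e => if he : (c e : ℕ) = j then leftVec K c y j ⟨e, he⟩ else 0

end Cyclic

/-- The circulant matrix with first row `1, ρ, ρ², …, ρ^{h-1}`. -/
def matTheta (ρ : ℝ) (h : ℕ) : Matrix (Fin h) (Fin h) ℝ :=
  Matrix.of fun i j => ρ ^ (((j : ℕ) + (h - (i : ℕ))) % h)

/-- The cyclic permutation matrix: the entry `1` of row `i` is in column `i + 1` modulo `h`. -/
def matP (h : ℕ) : Matrix (Fin h) (Fin h) ℝ :=
  Matrix.of fun i j => if (j : ℕ) = ((i : ℕ) + 1) % h then 1 else 0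

/-- A bipartite graph with edge set `E`, left (bit) nodes `L` and right (check) nodes `R`; parallel
edges are allowed. -/
structure BipartiteGraph (E L R : Type*) where
  left : E → L
  right : E → R

namespace BipartiteGraph

variable {E L R : Type*} (B : BipartiteGraph E L R)

/-- The simple graph on all the nodes in which two nodes are adjacent when an edge joins them. -/
def nodeGraph : SimpleGraph (L ⊕ R) :=
  SimpleGraph.fromRel fun x y => ∃ e, x = Sum.inl (B.left e) ∧ y = Sum.inr (B.right e)

def leftDegree (l : L) : ℕ := Nat.card {e : E // B.left e = l}

def rightDegree (r : R) : ℕ := Nat.card {e : E // B.right e = r}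

/-- `g` is an edge other than `f` with the same right node; if all right degrees are `2`, then each
`f` has exactly one such `g`, its conjugate. -/
def IsConj (f g : E) : Prop := g ≠ f ∧ B.right g = B.right f

open Classical in
/-- The flow matrix: the entry at `(e, f)` is `1` if the conjugate of `f` is different from `e` and
has the same left node as `e`, and `0` otherwise. -/
def flowMatrix : Matrix E E ℝ :=
  Matrix.of fun e f => if ∃ g, B.IsConj f g ∧ B.left g = B.left e ∧ g ≠ e then 1 else 0

end BipartiteGraph

end

end FlowLimit

/-!
A positive matrix, scaled to have Perron root one, contracts the row vectors orthogonal to its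
positive right eigenvector, so the normalized powers of a primitive matrix with Perron pair `y`,
`z` converge to `z y`. The index of imprimitivity `h` of `K` is the gcd of its return times; hence
the diagonal blocks of `K ^ h` are primitive, and `ρ ^ (-k) K ^ k` converges to `Z P ^ k Y` as `k`
runs through a residue class modulo `h`. A weighted Cesàro mean turns these limits, summed over
`h` consecutive exponents, into `∑ s < h, ρ ^ (r + s) Z P ^ (r + s) Y = ρ ^ r Z P ^ r Θ Y`.

For a flow matrix, let each edge step to a uniformly random sibling at its left node and then to
the conjugate of that sibling. This chain is doubly stochastic, so reachability is symmetric; a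
left node of degree at least three lets a walk turn around, and connectedness then gives
irreducibility. The column sums are at least one and not all equal to one, so the Perron root
exceeds one.
-/

namespace FlowLimit

open Matrix

section PerronFrobenius

variable {n : Type*} [Fintype n]

theorem mulVec_nonneg {A : Matrix n n ℝ} (hA : ∀ i j, 0 ≤ A i j) {v : n → ℝ} (hv : 0 ≤ v) :
    0 ≤ A *ᵥ v :=
  fun i ↦ dotProduct_nonneg_of_nonneg (hA i) hv

theorem mulVec_mono {A : Matrix n n ℝ} (hA : ∀ i j, 0 ≤ A i j) {v w : n → ℝ} (h : v ≤ w) :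
    A *ᵥ v ≤ A *ᵥ w :=
  fun i ↦ dotProduct_le_dotProduct_of_nonneg_left h (hA i)

theorem dotProduct_pos {v w : n → ℝ} (hv : ∀ i, 0 < v i) (hw : 0 ≤ w) (hw0 : w ≠ 0) :
    0 < v ⬝ᵥ w := by
  obtain ⟨j, hj⟩ := Function.ne_iff.mp hw0
  exact Finset.sum_pos' (fun k _ ↦ mul_nonneg (hv k).le (hw k))
    ⟨j, Finset.mem_univ j, mul_pos (hv j) ((hw j).lt_of_ne' hj)⟩

theorem norm_smul_le_mulVec_norm {A : Matrix n n ℝ} (hA : ∀ i j, 0 ≤ A i j) {μ : ℂ}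
    {v : n → ℂ} (h : A.map (algebraMap ℝ ℂ) *ᵥ v = μ • v) :
    ‖μ‖ • (fun i ↦ ‖v i‖) ≤ A *ᵥ fun i ↦ ‖v i‖ := by
  intro i
  calc ‖μ‖ * ‖v i‖ = ‖(A.map (algebraMap ℝ ℂ) *ᵥ v) i‖ := by
        rw [h, Pi.smul_apply, smul_eq_mul, norm_mul]
    _ ≤ ∑ j, ‖(A i j : ℂ) * v j‖ := norm_sum_le _ _
    _ = (A *ᵥ fun j ↦ ‖v j‖) i := by simp [mulVec, dotProduct, abs_of_nonneg (hA i _)]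

section Spectral

variable [DecidableEq n]

attribute [local instance] Matrix.linftyOpNormedRing Matrix.linftyOpNormedAlgebra

theorem ofReal_le_spectralRadius_of_pow_le_norm_pow {𝔸 : Type*} [NormedRing 𝔸]
    [NormedAlgebra ℂ 𝔸] [CompleteSpace 𝔸] {a : 𝔸} {r : ℝ} (hr : 0 ≤ r)
    (h : ∀ k : ℕ, r ^ k ≤ ‖a ^ k‖) : ENNReal.ofReal r ≤ spectralRadius ℂ a := by
  refine ge_of_tendsto (spectrum.pow_norm_pow_one_div_tendsto_nhds_spectralRadius a) ?_
  filter_upwards [eventually_gt_atTop 0] with k hk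
  refine ENNReal.ofReal_le_ofReal ?_
  calc r = (r ^ k) ^ (1 / k : ℝ) := by rw [one_div, Real.pow_rpow_inv_natCast hr hk.ne']
    _ ≤ ‖a ^ k‖ ^ (1 / k : ℝ) := Real.rpow_le_rpow (pow_nonneg hr k) (h k) (by positivity)

theorem pow_smul_le_pow_mulVec {A : Matrix n n ℝ} (hA : ∀ i j, 0 ≤ A i j) {w : n → ℝ} {r : ℝ}
    (hr : 0 ≤ r) (h : r • w ≤ A *ᵥ w) (k : ℕ) : r ^ k • w ≤ (A ^ k) *ᵥ w := by
  induction k with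
  | zero => simp
  | succ k ih =>
    calc r ^ (k + 1) • w = r ^ k • (r • w) := by rw [smul_smul, pow_succ]
      _ ≤ r ^ k • (A *ᵥ w) := smul_le_smul_of_nonneg_left h (pow_nonneg hr k)
      _ = A *ᵥ (r ^ k • w) := (mulVec_smul _ _ _).symm
      _ ≤ A *ᵥ ((A ^ k) *ᵥ w) := mulVec_mono hA ih
      _ = (A ^ (k + 1)) *ᵥ w := by rw [mulVec_mulVec, pow_succ']

theorem le_norm_map_of_smul_le_mulVec {A : Matrix n n ℝ} {w : n → ℝ} (hw : 0 ≤ w) (hw0 : w ≠ 0)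
    {r : ℝ} (h : r • w ≤ A *ᵥ w) : r ≤ ‖A.map (algebraMap ℝ ℂ)‖ := by
  obtain ⟨j, hj⟩ := Function.ne_iff.mp hw0
  have : Nonempty n := ⟨j⟩
  obtain ⟨i, hi⟩ := Finite.exists_max w
  have hwi : 0 < w i := ((hw j).lt_of_ne' hj).trans_le (hi j)
  set v : n → ℂ := fun j ↦ (w j : ℂ)
  have hv : ‖v‖ ≤ w i :=
    (pi_norm_le_iff_of_nonneg hwi.le).mpr fun j ↦ by simpa [v, abs_of_nonneg (hw j)] using hi j
  have hAv : (A.map (algebraMap ℝ ℂ) *ᵥ v) i = ((A *ᵥ w) i : ℂ) := by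
    simp [mulVec, dotProduct, v]
  refine le_of_mul_le_mul_right ?_ hwi
  calc r * w i ≤ (A *ᵥ w) i := h i
    _ ≤ ‖(A.map (algebraMap ℝ ℂ) *ᵥ v) i‖ := by
      rw [hAv, Complex.norm_real]; exact le_abs_self _
    _ ≤ ‖A.map (algebraMap ℝ ℂ) *ᵥ v‖ := norm_le_pi_norm _ i
    _ ≤ ‖A.map (algebraMap ℝ ℂ)‖ * ‖v‖ := Matrix.linfty_opNorm_mulVec _ _
    _ ≤ ‖A.map (algebraMap ℝ ℂ)‖ * w i := by gcongr

theorem le_perronRoot_of_smul_le_mulVec {A : Matrix n n ℝ} (hA : ∀ i j, 0 ≤ A i j) {w : n → ℝ}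
    (hw : 0 ≤ w) (hw0 : w ≠ 0) {r : ℝ} (hr : 0 ≤ r) (h : r • w ≤ A *ᵥ w) :
    r ≤ perronRoot A := by
  obtain ⟨j, -⟩ := Function.ne_iff.mp hw0
  have : Nonempty n := ⟨j⟩
  have hfinite : spectralRadius ℂ (A.map (algebraMap ℝ ℂ)) ≠ ⊤ :=
    ne_top_of_le_ne_top ENNReal.coe_ne_top (spectrum.spectralRadius_le_nnnorm _)
  refine (ENNReal.ofReal_le_iff_le_toReal hfinite).mp
    (ofReal_le_spectralRadius_of_pow_le_norm_pow hr fun k ↦ ?_)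
  rw [← Matrix.map_pow]
  exact le_norm_map_of_smul_le_mulVec hw hw0 (pow_smul_le_pow_mulVec hA hr h k)

theorem exists_eigenvector_norm_eq_perronRoot [Nonempty n] (A : Matrix n n ℝ) :
    ∃ (μ : ℂ) (v : n → ℂ), v ≠ 0 ∧ ‖μ‖ = perronRoot A ∧
      A.map (algebraMap ℝ ℂ) *ᵥ v = μ • v := by
  obtain ⟨μ, hμ, hnorm⟩ := spectrum.exists_nnnorm_eq_spectralRadius_of_nonempty
    (spectrum.nonempty_of_isAlgClosed_of_finiteDimensional ℂ (A.map (algebraMap ℝ ℂ)))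
  rw [← Matrix.spectrum_toLin', ← Module.End.hasEigenvalue_iff_mem_spectrum] at hμ
  obtain ⟨v, hv⟩ := hμ.exists_hasEigenvector
  exact ⟨μ, v, hv.2, by rw [perronRoot, ← hnorm]; simp, by simpa using hv.apply_eq_smul⟩

end Spectral

variable [DecidableEq n]

theorem perronRoot_le_of_mulVec_le_smul [Nonempty n] {A : Matrix n n ℝ} (hA : ∀ i j, 0 ≤ A i j)
    {w : n → ℝ} (hw : ∀ i, 0 < w i) {r : ℝ} (h : A *ᵥ w ≤ r • w) : perronRoot A ≤ r := by
  obtain ⟨μ, v, hv0, hμ, hv⟩ := exists_eigenvector_norm_eq_perronRoot A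
  rw [← hμ]
  obtain ⟨i, hi⟩ := Finite.exists_max fun j ↦ ‖v j‖ / w j
  have hvi : 0 < ‖v i‖ := by
    obtain ⟨j, hj⟩ := Function.ne_iff.mp hv0
    exact (div_pos_iff_of_pos_right (hw i)).mp
      ((div_pos (norm_pos_iff.mpr hj) (hw j)).trans_le (hi j))
  set t := ‖v i‖ / w i
  have ht : 0 ≤ t := by positivity [hw i]
  have hle : (fun j ↦ ‖v j‖) ≤ t • w := fun j ↦ by simpa [div_le_iff₀ (hw j)] using hi j
  refine le_of_mul_le_mul_right ?_ hvi
  calc ‖μ‖ * ‖v i‖ ≤ (A *ᵥ fun j ↦ ‖v j‖) i := norm_smul_le_mulVec_norm hA hv i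
    _ ≤ (A *ᵥ (t • w)) i := mulVec_mono hA hle i
    _ = t * (A *ᵥ w) i := by rw [mulVec_smul]; rfl
    _ ≤ t * (r * w i) := mul_le_mul_of_nonneg_left (h i) ht
    _ = r * ‖v i‖ := by rw [mul_left_comm, div_mul_cancel₀ _ (hw i).ne']

theorem perronRoot_eq_of_pos_eigenvector [Nonempty n] {A : Matrix n n ℝ}
    (hA : ∀ i j, 0 ≤ A i j) {w : n → ℝ} (hw : ∀ i, 0 < w i) {μ : ℝ} (h : A *ᵥ w = μ • w) :
    perronRoot A = μ := by
  obtain ⟨i⟩ := ‹Nonempty n›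
  have hμw : 0 ≤ μ • w := h ▸ mulVec_nonneg hA fun j ↦ (hw j).le
  have hμ : 0 ≤ μ := nonneg_of_mul_nonneg_left (hμw i) (hw i)
  exact le_antisymm (perronRoot_le_of_mulVec_le_smul hA hw h.le)
    (le_perronRoot_of_smul_le_mulVec hA (fun j ↦ (hw j).le)
      (Function.ne_iff.mpr ⟨i, (hw i).ne'⟩) hμ h.ge)

theorem lt_perronRoot_of_forall_lt_mulVec [Nonempty n] {A : Matrix n n ℝ}
    (hA : ∀ i j, 0 ≤ A i j) {w : n → ℝ} (hw : ∀ i, 0 < w i) {r : ℝ} (hr : 0 ≤ r)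
    (h : ∀ i, r * w i < (A *ᵥ w) i) : r < perronRoot A := by
  obtain ⟨i, hi⟩ := Finite.exists_min fun j ↦ (A *ᵥ w) j / w j
  have hlt : r < (A *ᵥ w) i / w i := (lt_div_iff₀ (hw i)).mpr (h i)
  refine hlt.trans_le (le_perronRoot_of_smul_le_mulVec hA (fun j ↦ (hw j).le)
    (Function.ne_iff.mpr ⟨i, (hw i).ne'⟩) (hr.trans hlt.le) fun j ↦ ?_)
  simpa [le_div_iff₀ (hw j)] using hi j

theorem exists_sum_pow_pos {A : Matrix n n ℝ} (hA : A.IsIrreducible) :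
    ∃ N : ℕ, ∀ i j, 0 < (∑ k ∈ Finset.range N, A ^ k) i j := by
  choose k _ hk using (isIrreducible_iff_exists_pow_pos hA.nonneg).mp hA
  refine ⟨(Finset.univ.sup fun p : n × n ↦ k p.1 p.2) + 1, fun i j ↦ ?_⟩
  rw [Matrix.sum_apply]
  refine Finset.sum_pos' (fun m _ ↦ pow_apply_nonneg hA.nonneg m i j) ⟨k i j, ?_, hk i j⟩
  rw [Finset.mem_range, Nat.lt_succ_iff]
  exact Finset.le_sup (f := fun p : n × n ↦ k p.1 p.2) (Finset.mem_univ (i, j))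

theorem exists_pos_eigenvector [Nonempty n] {A : Matrix n n ℝ} (hA : A.IsIrreducible) :
    ∃ w : n → ℝ, (∀ i, 0 < w i) ∧ A *ᵥ w = perronRoot A • w := by
  obtain ⟨μ, v, hv0, hμ, hv⟩ := exists_eigenvector_norm_eq_perronRoot A
  obtain ⟨N, hN⟩ := exists_sum_pow_pos hA
  set S := ∑ k ∈ Finset.range N, A ^ k
  have hcomm : Commute A S := Commute.sum_right _ _ _ fun k _ ↦ Commute.self_pow A k
  have hSA (x : n → ℝ) : S *ᵥ (A *ᵥ x) = A *ᵥ (S *ᵥ x) := by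
    rw [mulVec_mulVec, mulVec_mulVec, hcomm.eq]
  set u : n → ℝ := fun i ↦ ‖v i‖
  have hu0 : u ≠ 0 := fun h ↦ hv0 (funext fun i ↦ norm_eq_zero.mp (congrFun h i))
  have hsub : perronRoot A • u ≤ A *ᵥ u := hμ ▸ norm_smul_le_mulVec_norm hA.nonneg hv
  have hSu : ∀ i, 0 < (S *ᵥ u) i := fun i ↦ dotProduct_pos (hN i) (fun j ↦ norm_nonneg _) hu0
  -- Otherwise `S` turns the deficit into a strict inequality for `S u` in every coordinate.
  have heq : A *ᵥ u = perronRoot A • u := by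
    by_contra hne
    refine (lt_perronRoot_of_forall_lt_mulVec (r := perronRoot A) hA.nonneg hSu
      ENNReal.toReal_nonneg fun i ↦ ?_).false
    have hpos : 0 < (S *ᵥ (A *ᵥ u - perronRoot A • u)) i :=
      dotProduct_pos (hN i) (sub_nonneg.mpr hsub) (sub_ne_zero.mpr hne)
    rw [mulVec_sub, mulVec_smul, hSA] at hpos
    exact sub_pos.mp hpos
  exact ⟨S *ᵥ u, hSu, by rw [← hSA, heq, mulVec_smul]⟩

theorem lt_perronRoot_of_smul_lt_vecMul {A : Matrix n n ℝ} (hA : A.IsIrreducible) {y : n → ℝ}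
    (hy : 0 ≤ y) {r : ℝ} (h : r • y < y ᵥ* A) : r < perronRoot A := by
  obtain ⟨hle, i, hi⟩ := Pi.lt_def.mp h
  have : Nonempty n := ⟨i⟩
  obtain ⟨w, hw, hAw⟩ := exists_pos_eigenvector hA
  have hlt : r * (y ⬝ᵥ w) < perronRoot A * (y ⬝ᵥ w) := by
    calc r * (y ⬝ᵥ w) = ∑ j, r * y j * w j := by simp [dotProduct, Finset.mul_sum, mul_assoc]
      _ < (y ᵥ* A) ⬝ᵥ w := Finset.sum_lt_sum
        (fun j _ ↦ mul_le_mul_of_nonneg_right (hle j) (hw j).le)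
        ⟨i, Finset.mem_univ i, mul_lt_mul_of_pos_right hi (hw i)⟩
      _ = perronRoot A * (y ⬝ᵥ w) := by rw [← dotProduct_mulVec, hAw, dotProduct_smul, smul_eq_mul]
  exact lt_of_mul_lt_mul_right hlt (dotProduct_nonneg_of_nonneg hy fun j ↦ (hw j).le)

omit [Fintype n] [DecidableEq n] in
theorem exists_apply_pos [Finite n] {A : Matrix n n ℝ} (hA : A.IsIrreducible) (i : n) :
    ∃ j, 0 < A i j := by
  classical
  have := Fintype.ofFinite n
  obtain ⟨k, hk, hpos⟩ := (isIrreducible_iff_exists_pow_pos hA.nonneg).mp hA i i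
  obtain ⟨k, rfl⟩ := Nat.exists_eq_succ_of_ne_zero hk.ne'
  rw [pow_succ', mul_apply] at hpos
  obtain ⟨j, -, hj⟩ := Finset.exists_ne_zero_of_sum_ne_zero hpos.ne'
  exact ⟨j, (hA.nonneg i j).lt_of_ne' (left_ne_zero_of_mul hj)⟩

theorem perronRoot_pos [Nonempty n] {A : Matrix n n ℝ} (hA : A.IsIrreducible) :
    0 < perronRoot A := by
  refine lt_perronRoot_of_forall_lt_mulVec hA.nonneg (w := 1) (fun _ ↦ one_pos) le_rfl fun i ↦ ?_
  obtain ⟨j, hj⟩ := exists_apply_pos hA i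
  rw [zero_mul, mulVec, dotProduct_comm]
  exact dotProduct_pos (fun _ ↦ one_pos) (hA.nonneg i) (Function.ne_iff.mpr ⟨j, hj.ne'⟩)

end PerronFrobenius

section Primitive

variable {n : Type*} [Fintype n]

theorem abs_vecMul_dotProduct_le {C : Matrix n n ℝ} (hC : ∀ i j, 0 ≤ C i j) {w : n → ℝ}
    (hw : 0 ≤ w) {θ : ℝ} (h : C *ᵥ w = θ • w) (x : n → ℝ) :
    |x ᵥ* C| ⬝ᵥ w ≤ θ * (|x| ⬝ᵥ w) := by
  have habs : |x ᵥ* C| ≤ |x| ᵥ* C := fun j ↦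
    calc |∑ i, x i * C i j| ≤ ∑ i, |x i * C i j| := Finset.abs_sum_le_sum_abs _ _
      _ = ∑ i, |x i| * C i j := by simp only [abs_mul, abs_of_nonneg (hC _ j)]
  calc |x ᵥ* C| ⬝ᵥ w ≤ (|x| ᵥ* C) ⬝ᵥ w := dotProduct_le_dotProduct_of_nonneg_right habs hw
    _ = θ * (|x| ⬝ᵥ w) := by rw [← dotProduct_mulVec, h, dotProduct_smul, smul_eq_mul]

-- Doeblin's argument: subtracting from `A` a small positive multiple of `w 1ᵀ`, which annihilates
-- the rows orthogonal to `w`, leaves a nonnegative matrix with a smaller Perron root.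
theorem exists_contraction_of_pos [Nonempty n] {A : Matrix n n ℝ} (hA : ∀ i j, 0 < A i j)
    {w : n → ℝ} (hw : ∀ i, 0 < w i) (hAw : A *ᵥ w = w) :
    ∃ θ < 1, ∀ x : n → ℝ, x ⬝ᵥ w = 0 → |x ᵥ* A| ⬝ᵥ w ≤ θ * (|x| ⬝ᵥ w) := by
  obtain ⟨p, hp⟩ := Finite.exists_min fun p : n × n ↦ A p.1 p.2 / w p.1
  set δ := A p.1 p.2 / w p.1
  have hδ : 0 < δ := div_pos (hA _ _) (hw _)
  set C : Matrix n n ℝ := A - δ • vecMulVec w 1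
  have hC (i j : n) : 0 ≤ C i j := by
    simpa [C, vecMulVec_apply] using (le_div_iff₀ (hw i)).mp (hp (i, j))
  have hCw : C *ᵥ w = (1 - δ * (1 ⬝ᵥ w)) • w := by
    rw [sub_mulVec, hAw, smul_mulVec, vecMulVec_mulVec, op_smul_eq_smul, smul_smul, sub_smul,
      one_smul]
  refine ⟨1 - δ * (1 ⬝ᵥ w), sub_lt_self _ (mul_pos hδ ?_), fun x hx ↦ ?_⟩
  · obtain ⟨i⟩ := ‹Nonempty n›
    exact dotProduct_pos (fun _ ↦ one_pos) (fun i ↦ (hw i).le)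
      (Function.ne_iff.mpr ⟨i, (hw i).ne'⟩)
  · have hxC : x ᵥ* C = x ᵥ* A := by
      rw [vecMul_sub, vecMul_smul, vecMul_vecMulVec, hx, zero_smul, smul_zero, sub_zero]
    exact hxC ▸ abs_vecMul_dotProduct_le hC (fun i ↦ (hw i).le) hCw x

theorem tendsto_zero_of_antitone_of_le_mul {a : ℕ → ℝ} (ha : Antitone a) (ha0 : ∀ m, 0 ≤ a m)
    {θ : ℝ} (hθ : θ < 1) {N : ℕ} (h : ∀ m, a (m + N) ≤ θ * a m) : Tendsto a atTop (𝓝 0) := by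
  have hlim : Tendsto a atTop (𝓝 (⨅ m, a m)) :=
    tendsto_atTop_ciInf ha ⟨0, Set.forall_mem_range.mpr ha0⟩
  have hle : ⨅ m, a m ≤ θ * ⨅ m, a m :=
    le_of_tendsto_of_tendsto' ((tendsto_add_atTop_iff_nat N).mpr hlim) (hlim.const_mul θ) h
  have hzero : ⨅ m, a m = 0 := by nlinarith [le_ciInf ha0]
  rwa [hzero] at hlim

variable [DecidableEq n]

theorem pow_mulVec_eq_smul {A : Matrix n n ℝ} {w : n → ℝ} {μ : ℝ} (h : A *ᵥ w = μ • w) (k : ℕ) :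
    (A ^ k) *ᵥ w = μ ^ k • w := by
  induction k with
  | zero => simp
  | succ k ih => rw [pow_succ, ← mulVec_mulVec, h, mulVec_smul, ih, smul_smul, pow_succ']

theorem pow_mulVec_eq_self {A : Matrix n n ℝ} {w : n → ℝ} (h : A *ᵥ w = w) (k : ℕ) :
    (A ^ k) *ᵥ w = w := by
  simpa using pow_mulVec_eq_smul (μ := 1) (by simpa using h) k

theorem tendsto_vecMul_pow_zero {A : Matrix n n ℝ} (hA : A.IsPrimitive) {w : n → ℝ}
    (hw : ∀ i, 0 < w i) (hAw : A *ᵥ w = w) {x : n → ℝ} (hx : x ⬝ᵥ w = 0) :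
    Tendsto (fun m ↦ x ᵥ* (A ^ m)) atTop (𝓝 0) := by
  cases isEmpty_or_nonempty n with
  | inl _ => exact tendsto_pi_nhds.mpr fun i ↦ isEmptyElim i
  | inr _ =>
  have hw0 : 0 ≤ w := fun i ↦ (hw i).le
  obtain ⟨N, -, hN⟩ := hA.exists_pos_pow
  obtain ⟨θ, hθ, hcontr⟩ := exists_contraction_of_pos hN hw (pow_mulVec_eq_self hAw N)
  have horth (m : ℕ) : (x ᵥ* (A ^ m)) ⬝ᵥ w = 0 := by
    rw [← dotProduct_mulVec, pow_mulVec_eq_self hAw, hx]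
  have hlim : Tendsto (fun m ↦ |x ᵥ* (A ^ m)| ⬝ᵥ w) atTop (𝓝 0) := by
    refine tendsto_zero_of_antitone_of_le_mul (antitone_nat_of_succ_le fun m ↦ ?_)
      (fun m ↦ dotProduct_nonneg_of_nonneg (abs_nonneg _) hw0) hθ (N := N) fun m ↦ ?_
    · rw [pow_succ, ← vecMul_vecMul]
      exact (abs_vecMul_dotProduct_le hA.nonneg hw0 (hAw.trans (one_smul ℝ w).symm) _).trans_eq
        (one_mul _)
    · rw [pow_add, ← vecMul_vecMul]
      exact hcontr _ (horth m)
  refine tendsto_pi_nhds.mpr fun j ↦ squeeze_zero_norm (fun m ↦ ?_)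
    (by simpa using hlim.div_const (w j))
  rw [le_div_iff₀ (hw j)]
  exact Finset.single_le_sum (f := fun j ↦ |x ᵥ* (A ^ m)| j * w j)
    (fun k _ ↦ mul_nonneg (abs_nonneg _) (hw0 k)) (Finset.mem_univ j)

theorem dotProduct_eq_zero_of_fixed {A : Matrix n n ℝ} (hA : A.IsPrimitive) {w x z : n → ℝ}
    (hw : ∀ i, 0 < w i) (hAw : A *ᵥ w = w) (hz : A *ᵥ z = z) (hx : x ⬝ᵥ w = 0) :
    x ⬝ᵥ z = 0 := by
  have hlim : Tendsto (fun m ↦ (x ᵥ* (A ^ m)) ⬝ᵥ z) atTop (𝓝 (0 ⬝ᵥ z)) :=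
    ((continuous_id.dotProduct continuous_const).tendsto _).comp
      (tendsto_vecMul_pow_zero hA hw hAw hx)
  simp only [← dotProduct_mulVec, pow_mulVec_eq_self hz, zero_dotProduct] at hlim
  exact tendsto_nhds_unique tendsto_const_nhds hlim

theorem tendsto_pow_vecMulVec {A : Matrix n n ℝ} (hA : A.IsPrimitive) {w y z : n → ℝ}
    (hw : ∀ i, 0 < w i) (hAw : A *ᵥ w = w) (hy : y ᵥ* A = y) (hz : A *ᵥ z = z)
    (hyz : y ⬝ᵥ z = 1) : Tendsto (fun m ↦ A ^ m) atTop (𝓝 (vecMulVec z y)) := by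
  have hyA (m : ℕ) : y ᵥ* (A ^ m) = y := by
    rw [← mulVec_transpose, transpose_pow]
    exact pow_mulVec_eq_self (by rw [mulVec_transpose, hy]) m
  refine tendsto_pi_nhds.mpr fun i ↦ ?_
  have hzw : z i * (y ⬝ᵥ w) = w i := by
    have hx : ((y ⬝ᵥ w) • Pi.single i 1 - w i • y) ⬝ᵥ w = 0 := by simp [sub_dotProduct, mul_comm]
    have hxz := dotProduct_eq_zero_of_fixed hA hw hAw hz hx
    simp only [sub_dotProduct, smul_dotProduct, single_one_dotProduct, hyz, smul_eq_mul,
      mul_one] at hxz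
    linarith
  have hlim := tendsto_vecMul_pow_zero hA hw hAw (x := Pi.single i 1 - z i • y)
    (by simp [sub_dotProduct, hzw])
  simp only [sub_vecMul, smul_vecMul, hyA, single_one_vecMul] at hlim
  exact tendsto_sub_nhds_zero_iff.mp hlim

theorem isPrimitive_smul {A : Matrix n n ℝ} (hA : A.IsPrimitive) {a : ℝ} (ha : 0 < a) :
    (a • A).IsPrimitive := by
  obtain ⟨N, hN0, hN⟩ := hA.exists_pos_pow
  refine ⟨fun i j ↦ mul_nonneg ha.le (hA.nonneg i j), N, hN0, fun i j ↦ ?_⟩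
  rw [smul_pow]
  exact mul_pos (pow_pos ha N) (hN i j)

theorem IsPerronPair.tendsto_pow {A : Matrix n n ℝ} (hA : A.IsPrimitive) {y z : n → ℝ}
    (hyz : IsPerronPair A y z) :
    Tendsto (fun m ↦ (perronRoot A ^ m)⁻¹ • A ^ m) atTop (𝓝 (vecMulVec z y)) := by
  cases isEmpty_or_nonempty n with
  | inl _ => exact tendsto_pi_nhds.mpr fun i ↦ isEmptyElim i
  | inr _ =>
  obtain ⟨w, hw, hAw⟩ := exists_pos_eigenvector hA.isIrreducible
  have hρ : 0 < perronRoot A := perronRoot_pos hA.isIrreducible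
  have hscale (v : n → ℝ) : (perronRoot A)⁻¹ • perronRoot A • v = v := inv_smul_smul₀ hρ.ne' v
  have hlim := tendsto_pow_vecMulVec (isPrimitive_smul hA (inv_pos.mpr hρ)) hw
    (by rw [smul_mulVec, hAw, hscale]) (by rw [vecMul_smul, hyz.left_eigen, hscale])
    (by rw [smul_mulVec, hyz.right_eigen, hscale]) hyz.normalized
  simpa only [smul_pow, inv_pow] using hlim

end Primitive

section Period

variable {n : Type*} [Fintype n] [DecidableEq n]

theorem pow_add_apply_pos {K : Matrix n n ℝ} (hK : ∀ i j, 0 ≤ K i j) {a b : ℕ} {e f g : n}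
    (hef : 0 < (K ^ a) e f) (hfg : 0 < (K ^ b) f g) : 0 < (K ^ (a + b)) e g := by
  rw [pow_add, mul_apply]
  exact Finset.sum_pos' (fun k _ ↦ mul_nonneg (pow_apply_nonneg hK a e k)
    (pow_apply_nonneg hK b k g)) ⟨f, Finset.mem_univ f, mul_pos hef hfg⟩

theorem exists_pow_apply_pos {K : Matrix n n ℝ} (hK : K.IsIrreducible) (e : n) (k : ℕ) :
    ∃ f, 0 < (K ^ k) e f := by
  induction k with
  | zero => exact ⟨e, by simp⟩
  | succ k ih =>
    obtain ⟨f, hf⟩ := ih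
    obtain ⟨g, hg⟩ := exists_apply_pos hK f
    exact ⟨g, pow_add_apply_pos hK.nonneg hf (by rwa [pow_one])⟩

/-- The lengths of the closed walks at `e` along nonzero entries of `K`. The greatest common divisor
of these lengths is the period of `K`. -/
def returnTimes {K : Matrix n n ℝ} (hK : ∀ i j, 0 ≤ K i j) (e : n) : AddSubmonoid ℕ where
  carrier := {k | 0 < (K ^ k) e e}
  zero_mem' := by simp
  add_mem' := pow_add_apply_pos hK

theorem setGcd_returnTimes_pos {K : Matrix n n ℝ} (hK : K.IsIrreducible) (e : n) :
    0 < Nat.setGcd (returnTimes hK.nonneg e) := by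
  obtain ⟨k, hk, hpos⟩ := (isIrreducible_iff_exists_pow_pos hK.nonneg).mp hK e e
  exact Nat.pos_of_dvd_of_pos
    (Nat.setGcd_dvd_of_mem (s := returnTimes hK.nonneg e) hpos) hk

theorem modEq_setGcd_returnTimes {K : Matrix n n ℝ} (hK : K.IsIrreducible) {e f : n} {a b : ℕ}
    (ha : 0 < (K ^ a) e f) (hb : 0 < (K ^ b) e f) :
    a ≡ b [MOD Nat.setGcd (returnTimes hK.nonneg e)] := by
  obtain ⟨l, -, hl⟩ := (isIrreducible_iff_exists_pow_pos hK.nonneg).mp hK f e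
  have hreturn {k : ℕ} (hk : 0 < (K ^ k) e f) :
      k + l ≡ 0 [MOD Nat.setGcd (returnTimes hK.nonneg e)] :=
    Nat.modEq_zero_iff_dvd.mpr (Nat.setGcd_dvd_of_mem (s := returnTimes hK.nonneg e)
      (pow_add_apply_pos hK.nonneg hk hl))
  exact Nat.ModEq.add_right_cancel' l ((hreturn ha).trans (hreturn hb).symm)

theorem exists_isCyclicPartition_setGcd {K : Matrix n n ℝ} (hK : K.IsIrreducible) (e : n) :
    ∃ c : n → Fin (Nat.setGcd (returnTimes hK.nonneg e)), IsCyclicPartition K c := by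
  set d := Nat.setGcd (returnTimes hK.nonneg e)
  choose k _ hk using (isIrreducible_iff_exists_pow_pos hK.nonneg).mp hK e
  refine ⟨fun f ↦ ⟨k f % d, Nat.mod_lt _ (setGcd_returnTimes_pos hK e)⟩, fun j ↦ ?_,
    fun f g hfg ↦ ?_⟩
  · obtain ⟨f, hf⟩ := exists_pow_apply_pos hK e j
    have hmod : k f % d = j % d := modEq_setGcd_returnTimes hK (hk f) hf
    exact ⟨f, Fin.ext (hmod.trans (Nat.mod_eq_of_lt j.2))⟩
  · have hstep : 0 < (K ^ 1) f g := by
      rw [pow_one]; exact (hK.nonneg f g).lt_of_ne' hfg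
    rw [Nat.mod_add_mod]
    exact modEq_setGcd_returnTimes hK (hk g) (pow_add_apply_pos hK.nonneg (hk f) hstep)

theorem IsCyclicPartition.class_of_pow_ne_zero {K : Matrix n n ℝ} {h : ℕ} {c : n → Fin h}
    (hc : IsCyclicPartition K c) {k : ℕ} {e f : n} (hef : (K ^ k) e f ≠ 0) :
    (c f : ℕ) = (c e + k) % h := by
  induction k generalizing f with
  | zero =>
    obtain rfl : e = f := by
      by_contra hne
      exact hef (one_apply_ne hne)
    exact (Nat.mod_eq_of_lt (c e).2).symm
  | succ k ih =>
    rw [pow_succ, mul_apply] at hef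
    obtain ⟨g, _, hg⟩ := Finset.exists_ne_zero_of_sum_ne_zero hef
    rw [hc.step g f (right_ne_zero_of_mul hg), ih (left_ne_zero_of_mul hg), Nat.mod_add_mod,
      add_assoc]

theorem IsCyclicPartition.dvd_of_pow_ne_zero {K : Matrix n n ℝ} {h : ℕ} {c : n → Fin h}
    (hc : IsCyclicPartition K c) {k : ℕ} {e f : n} (hcls : c e = c f) (hef : (K ^ k) e f ≠ 0) :
    h ∣ k := by
  have hmod : (c e : ℕ) + k ≡ c e [MOD h] := by
    rw [Nat.ModEq, ← hc.class_of_pow_ne_zero hef, hcls, Nat.mod_eq_of_lt (c f).2]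
  exact (Nat.modEq_zero_iff_dvd).mp (Nat.ModEq.add_left_cancel' (c e : ℕ) hmod)

theorem IsImprimitivityIndex.eq_setGcd {K : Matrix n n ℝ} (hK : K.IsIrreducible) {h : ℕ}
    (hh : IsImprimitivityIndex K h) (e : n) : h = Nat.setGcd (returnTimes hK.nonneg e) := by
  have hpos := setGcd_returnTimes_pos hK e
  obtain ⟨⟨-, c, hc⟩, hmax⟩ := hh
  exact le_antisymm
    (Nat.le_of_dvd hpos (Nat.dvd_setGcd_iff.mpr fun k hk ↦ hc.dvd_of_pow_ne_zero rfl (ne_of_gt hk)))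
    (hmax ⟨hpos, exists_isCyclicPartition_setGcd hK e⟩)

theorem eventually_pow_apply_pos {K : Matrix n n ℝ} (hK : K.IsIrreducible) {h : ℕ}
    (hh : IsImprimitivityIndex K h) {c : n → Fin h} (hc : IsCyclicPartition K c) {e f : n}
    (hef : c e = c f) : ∀ᶠ m in atTop, 0 < (K ^ (h * m)) e f := by
  obtain ⟨k, -, hk⟩ := (isIrreducible_iff_exists_pow_pos hK.nonneg).mp hK e f
  obtain ⟨l, rfl⟩ := hc.dvd_of_pow_ne_zero hef hk.ne'
  obtain ⟨N, hN⟩ := Nat.exists_mem_closure_of_ge (returnTimes hK.nonneg e)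
  rw [AddSubmonoid.closure_eq, ← hh.eq_setGcd hK e] at hN
  have hreturn : ∀ m ≥ N, 0 < (K ^ (h * m)) e e := fun m hm ↦
    hN (h * m) (hm.le.trans (Nat.le_mul_of_pos_left m hh.1.1)) (dvd_mul_right h m)
  filter_upwards [eventually_ge_atTop (N + l)] with m hm
  obtain ⟨m, rfl⟩ := Nat.exists_eq_add_of_le (le_of_add_le_right hm)
  rw [add_comm l m, mul_add]
  exact pow_add_apply_pos hK.nonneg (hreturn m (by omega)) hk

end Period

section Blocks

variable {n : Type*} [Fintype n] {h : ℕ} {c : n → Fin h}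

theorem sum_cls_eq_sum {b : ℕ} {F : n → ℝ} (hF : ∀ g, F g ≠ 0 → (c g : ℕ) = b) :
    ∑ g : Cls c b, F g = ∑ g, F g := by
  refine Fintype.sum_of_injective Subtype.val Subtype.val_injective _ _ (fun g hg ↦ ?_)
    fun _ ↦ rfl
  by_contra hne
  exact hg ⟨⟨g, hF g hne⟩, rfl⟩

variable [DecidableEq n] {K : Matrix n n ℝ}

theorem IsCyclicPartition.block_pow_mul (hc : IsCyclicPartition K c) {a b d k : ℕ}
    (hb : (a + k) % h = b) (B : Matrix n n ℝ) :
    block (K ^ k * B) c a d = block (K ^ k) c a b * block B c b d := by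
  ext e f
  exact (sum_cls_eq_sum (F := fun g ↦ (K ^ k) e g * B g f) fun g hg ↦ by
    rw [hc.class_of_pow_ne_zero (left_ne_zero_of_mul hg), e.2, hb]).symm

theorem IsCyclicPartition.block_pow_mulVec (hc : IsCyclicPartition K c) {a b k : ℕ}
    (hb : (a + k) % h = b) (w : n → ℝ) :
    (block (K ^ k) c a b *ᵥ fun g ↦ w g) = fun e : Cls c a ↦ ((K ^ k) *ᵥ w) e := by
  ext e
  exact sum_cls_eq_sum (F := fun g ↦ (K ^ k) e g * w g) fun g hg ↦ by
    rw [hc.class_of_pow_ne_zero (left_ne_zero_of_mul hg), e.2, hb]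

theorem IsCyclicPartition.blockProd_eq (hc : IsCyclicPartition K c) {a k b : ℕ}
    (hk : a + k ≤ h) : blockProd K c a k b = block (K ^ k) c a b := by
  induction k generalizing b with
  | zero => rw [blockProd, pow_zero]
  | succ k ih =>
    rw [blockProd, ih (by omega), pow_succ, hc.block_pow_mul (Nat.mod_eq_of_lt (by omega))]

theorem IsCyclicPartition.cycleProd_eq (hc : IsCyclicPartition K c) :
    cycleProd K c = block (K ^ h) c 0 0 :=
  hc.blockProd_eq (zero_add h).le

theorem IsCyclicPartition.cycleProd_nonneg (hc : IsCyclicPartition K c) (hK : ∀ e f, 0 ≤ K e f)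
    (e f : Cls c 0) : 0 ≤ cycleProd K c e f := by
  rw [hc.cycleProd_eq]
  exact pow_apply_nonneg hK h e.1 f.1

theorem IsCyclicPartition.cycleProd_pow (hc : IsCyclicPartition K c) (m : ℕ) :
    cycleProd K c ^ m = block (K ^ (h * m)) c 0 0 := by
  induction m with
  | zero => exact (submatrix_one _ Subtype.val_injective).symm
  | succ m ih =>
    rw [pow_succ, ih, hc.cycleProd_eq, ← hc.block_pow_mul (by simp), ← pow_add, mul_add_one]

theorem IsCyclicPartition.block_pow_eq (hc : IsCyclicPartition K c) {a : ℕ} (ha : a ≤ h)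
    (m b : ℕ) : block (K ^ (h - a + h * m + b)) c a b =
      block (K ^ (h - a)) c a 0 * cycleProd K c ^ m * block (K ^ b) c 0 b := by
  rw [pow_add, pow_add, mul_assoc, hc.block_pow_mul (b := 0) (by simp [ha]),
    hc.block_pow_mul (b := 0) (by simp), ← hc.cycleProd_pow, Matrix.mul_assoc]

theorem isPrimitive_cycleProd (hK : K.IsIrreducible) (hh : IsImprimitivityIndex K h)
    (hc : IsCyclicPartition K c) : (cycleProd K c).IsPrimitive := by
  have hpos : ∀ᶠ m in atTop, ∀ e f, 0 < (cycleProd K c ^ m) e f := by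
    simp only [eventually_all, hc.cycleProd_pow]
    intro e f
    exact eventually_pow_apply_pos hK hh hc (Fin.ext (e.2.trans f.2.symm))
  exact ⟨hc.cycleProd_nonneg hK.nonneg, ((eventually_gt_atTop 0).and hpos).exists⟩

theorem perronRoot_cycleProd (hK : K.IsIrreducible) (hh : 0 < h) (hc : IsCyclicPartition K c) :
    perronRoot (cycleProd K c) = perronRoot K ^ h := by
  obtain ⟨e, he⟩ := hc.surjective ⟨0, hh⟩
  have : Nonempty n := ⟨e⟩
  have : Nonempty (Cls c 0) := ⟨⟨e, congrArg Fin.val he⟩⟩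
  obtain ⟨w, hw, hKw⟩ := exists_pos_eigenvector hK
  refine perronRoot_eq_of_pos_eigenvector (hc.cycleProd_nonneg hK.nonneg)
    (w := fun e ↦ w e) (fun e ↦ hw e) ?_
  rw [hc.cycleProd_eq, hc.block_pow_mulVec (by simp), pow_mulVec_eq_smul hKw]
  rfl

theorem IsCyclicPartition.rightVec_eq (hc : IsCyclicPartition K c) {a : ℕ} (ha : a ≤ h)
    (z : Cls c 0 → ℝ) :
    rightVec K c z a = ((perronRoot K ^ (h - a))⁻¹ • block (K ^ (h - a)) c a 0) *ᵥ z := by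
  rw [rightVec, hc.blockProd_eq (Nat.add_sub_cancel' ha).le, smul_mulVec]

theorem IsCyclicPartition.leftVec_eq (hc : IsCyclicPartition K c) {b : ℕ} (hb : b ≤ h)
    (y : Cls c 0 → ℝ) :
    leftVec K c y b = y ᵥ* ((perronRoot K ^ b)⁻¹ • block (K ^ b) c 0 b) := by
  rw [leftVec, hc.blockProd_eq (by simpa using hb), vecMul_smul]

theorem tendsto_block_pow (hK : K.IsIrreducible) (hh : IsImprimitivityIndex K h)
    (hc : IsCyclicPartition K c) {y z : Cls c 0 → ℝ} (hyz : IsPerronPair (cycleProd K c) y z)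
    {a b : ℕ} (ha : a ≤ h) (hb : b ≤ h) :
    Tendsto (fun m ↦ (perronRoot K ^ (h - a + h * m + b))⁻¹ • block (K ^ (h - a + h * m + b)) c a b)
      atTop (𝓝 (vecMulVec (rightVec K c z a) (leftVec K c y b))) := by
  have hlim := hyz.tendsto_pow (isPrimitive_cycleProd hK hh hc)
  simp only [perronRoot_cycleProd hK hh.1.1 hc, ← pow_mul] at hlim
  rw [hc.rightVec_eq ha, hc.leftVec_eq hb, ← vecMulVec_mul, ← mul_vecMulVec]
  have hfactor (m : ℕ) :
      (perronRoot K ^ (h - a + h * m + b))⁻¹ • block (K ^ (h - a + h * m + b)) c a b =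
        (perronRoot K ^ (h - a))⁻¹ • block (K ^ (h - a)) c a 0 *
          (perronRoot K ^ (h * m))⁻¹ • cycleProd K c ^ m *
          (perronRoot K ^ b)⁻¹ • block (K ^ b) c 0 b := by
    rw [hc.block_pow_eq ha, pow_add, pow_add]
    simp only [Matrix.smul_mul, Matrix.mul_smul, smul_smul, mul_inv]
    congr 1
    ring
  simp only [hfactor]
  exact (((continuous_const.matrix_mul continuous_id).matrix_mul continuous_const).tendsto _).comp
    hlim

end Blocks

section GeometricAverages

theorem sum_range_mul_add {M : Type*} [AddCommMonoid M] (F : ℕ → M) (h r q : ℕ) :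
    ∑ i ∈ Finset.range (h * q + r), F i =
      ∑ i ∈ Finset.range r, F i +
        ∑ m ∈ Finset.range q, ∑ s ∈ Finset.range h, F (r + s + h * m) := by
  induction q with
  | zero => simp
  | succ q ih =>
    rw [show h * (q + 1) + r = h * q + r + h by ring, Finset.sum_range_add, ih,
      Finset.sum_range_succ _ q, add_assoc]
    congr! 4
    ring

variable {E : Type*} [NormedAddCommGroup E] [NormedSpace ℝ E]

theorem tendsto_smul_sum_of_tendsto_inv_pow_smul {μ : ℝ} (hμ : 1 < μ) {b : ℕ → E} {v : E}
    (hb : Tendsto (fun m ↦ (μ ^ m)⁻¹ • b m) atTop (𝓝 v)) :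
    Tendsto (fun q ↦ ((μ - 1) / (μ ^ q - 1)) • ∑ m ∈ Finset.range q, b m) atTop (𝓝 v) := by
  have hμ0 (m : ℕ) : 0 < μ ^ m := pow_pos (one_pos.trans hμ) m
  have hdiv : Tendsto (fun q ↦ ∑ m ∈ Finset.range q, μ ^ m) atTop atTop :=
    tendsto_atTop_mono (fun q ↦ by
      simpa using Finset.card_nsmul_le_sum (Finset.range q) _ 1 fun m _ ↦ one_le_pow₀ hμ.le)
      tendsto_natCast_atTop_atTop
  have hlittle : (fun m ↦ b m - μ ^ m • v) =o[atTop] fun m ↦ μ ^ m := by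
    have herror := (Asymptotics.isLittleO_one_iff ℝ).mpr (tendsto_sub_nhds_zero_iff.mpr hb)
    refine ((Asymptotics.isBigO_refl (fun m ↦ μ ^ m) atTop).smul_isLittleO herror).congr
      (fun m ↦ ?_) fun m ↦ mul_one _
    rw [smul_sub, smul_inv_smul₀ (hμ0 m).ne']
  have hratio := (hlittle.sum_range (fun m ↦ (hμ0 m).le) hdiv).tendsto_inv_smul_nhds_zero
  refine tendsto_sub_nhds_zero_iff.mp (hratio.congr' ?_)
  filter_upwards [hdiv.eventually_gt_atTop 0] with q hq
  rw [Finset.sum_sub_distrib, ← Finset.sum_smul, smul_sub, inv_smul_smul₀ hq.ne',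
    geom_sum_eq hμ.ne', inv_div]

theorem tendsto_smul_sum_of_residue_classes {ρ : ℝ} (hρ : 1 < ρ) {h : ℕ} (hh : 0 < h)
    {F v : ℕ → E}
    (hF : ∀ k, Tendsto (fun m ↦ (ρ ^ (k + h * m))⁻¹ • F (k + h * m)) atTop (𝓝 (v k))) (r : ℕ) :
    Tendsto (fun q ↦ ((ρ ^ h - 1) / (ρ ^ (h * q) - 1)) • ∑ i ∈ Finset.range (h * q + r), F i)
      atTop (𝓝 (∑ s ∈ Finset.range h, ρ ^ (r + s) • v (r + s))) := by
  have hρh : 1 < ρ ^ h := one_lt_pow₀ hρ hh.ne'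
  have hblock : Tendsto (fun m ↦ ((ρ ^ h) ^ m)⁻¹ • ∑ s ∈ Finset.range h, F (r + s + h * m)) atTop
      (𝓝 (∑ s ∈ Finset.range h, ρ ^ (r + s) • v (r + s))) := by
    simp only [Finset.smul_sum]
    refine tendsto_finsetSum _ fun s _ ↦ ((hF (r + s)).const_smul (ρ ^ (r + s))).congr fun m ↦ ?_
    rw [smul_smul, pow_add ρ (r + s), mul_inv,
      mul_inv_cancel_left₀ (pow_pos (one_pos.trans hρ) _).ne', pow_mul]
  have hcoeff : Tendsto (fun q : ℕ ↦ (ρ ^ h - 1) / ((ρ ^ h) ^ q - 1)) atTop (𝓝 0) :=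
    (tendsto_atTop_add_const_right _ (-1) (tendsto_pow_atTop_atTop_of_one_lt hρh)).const_div_atTop _
  have hlim := (hcoeff.smul_const (∑ i ∈ Finset.range r, F i)).add
    (tendsto_smul_sum_of_tendsto_inv_pow_smul hρh hblock)
  simpa only [sum_range_mul_add, smul_add, pow_mul, zero_smul, zero_add] using hlim

end GeometricAverages

section Circulant

theorem matP_pow_apply {h : ℕ} (k : ℕ) (i j : Fin h) :
    (matP h ^ k) i j = if (j : ℕ) = (i + k) % h then 1 else 0 := by
  induction k generalizing j with
  | zero =>
    rw [pow_zero, one_apply, add_zero, Nat.mod_eq_of_lt i.2]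
    simp only [Fin.ext_iff, eq_comm]
  | succ k ih =>
    rw [pow_succ, mul_apply,
      Finset.sum_eq_single (⟨(i + k) % h, Nat.mod_lt _ i.pos⟩ : Fin h)]
    · rw [ih]
      simp [matP, add_assoc]
    · intro g _ hg
      rw [ih, if_neg fun hval ↦ hg (Fin.ext hval), zero_mul]
    · simp

theorem matTheta_eq_sum (ρ : ℝ) (h : ℕ) :
    matTheta ρ h = ∑ s ∈ Finset.range h, ρ ^ s • matP h ^ s := by
  ext i j
  have : NeZero h := ⟨i.pos.ne'⟩
  have hval (s : Fin h) : (matP h ^ (s : ℕ)) i j = if j - i = s then 1 else 0 := by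
    simp only [matP_pow_apply, ← Fin.val_add, ← Fin.ext_iff, sub_eq_iff_eq_add']
  have hexp : (j + (h - i)) % h = ((j - i : Fin h) : ℕ) := by rw [Fin.val_sub, add_comm]
  simp [Matrix.sum_apply, Finset.sum_range, hval, matTheta, hexp]

end Circulant

section Limit

variable {n : Type*} [Fintype n] [DecidableEq n] {K : Matrix n n ℝ} {h : ℕ} {c : n → Fin h}

theorem matZ_mul_matP_pow_mul_matY_apply (y z : Cls c 0 → ℝ) (k : ℕ) (e f : n) :
    (matZ K c z * matP h ^ k * matY K c y) e f =
      if (c f : ℕ) = (c e + k) % h then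
        rightVec K c z (c e) ⟨e, rfl⟩ * leftVec K c y (c f) ⟨f, rfl⟩ else 0 := by
  rw [mul_apply, Finset.sum_eq_single (c f), mul_apply, Finset.sum_eq_single (c e),
    matP_pow_apply]
  · simp [matZ, matY]
  · intro j _ hj
    rw [matZ, of_apply, dif_neg fun hval : (c e : ℕ) = j ↦ hj (Fin.ext hval.symm), zero_mul]
  · simp
  · intro j _ hj
    rw [matY, of_apply, dif_neg fun hval : (c f : ℕ) = j ↦ hj (Fin.ext hval.symm), mul_zero]
  · simp

theorem tendsto_pow_residue_class (hK : K.IsIrreducible) (hh : IsImprimitivityIndex K h)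
    (hc : IsCyclicPartition K c) {y z : Cls c 0 → ℝ} (hyz : IsPerronPair (cycleProd K c) y z)
    (k : ℕ) :
    Tendsto (fun m ↦ (perronRoot K ^ (k + h * m))⁻¹ • K ^ (k + h * m)) atTop
      (𝓝 (matZ K c z * matP h ^ k * matY K c y)) := by
  refine tendsto_pi_nhds.mpr fun e ↦ tendsto_pi_nhds.mpr fun f ↦ ?_
  rw [matZ_mul_matP_pow_mul_matY_apply]
  split_ifs with hcls
  · have hblock := tendsto_pi_nhds.mp (tendsto_pi_nhds.mp
      (tendsto_block_pow hK hh hc hyz (c e).2.le (c f).2.le) ⟨e, rfl⟩) ⟨f, rfl⟩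
    have hexp (m : ℕ) :
        k + h * (m + 1) = h - c e + h * (m + (c e + k) / h) + c f := by
      have hdiv := Nat.div_add_mod (c e + k) h
      have hle := (c e).2.le
      rw [← hcls] at hdiv
      rw [mul_add, mul_add, mul_one]
      omega
    refine (tendsto_add_atTop_iff_nat 1).mp ?_
    simp only [hexp]
    exact hblock.comp (tendsto_add_atTop_nat _)
  · refine tendsto_const_nhds.congr fun m ↦ ?_
    have hzero : (K ^ (k + h * m)) e f = 0 := by
      by_contra hne
      exact hcls (by rw [hc.class_of_pow_ne_zero hne, ← add_assoc, Nat.add_mul_mod_self_left])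
    rw [Matrix.smul_apply, hzero, smul_zero]

theorem sum_smul_matZ_mul_matP_pow_mul_matY (y z : Cls c 0 → ℝ) (ρ : ℝ) (r : ℕ) :
    ∑ s ∈ Finset.range h, ρ ^ (r + s) • (matZ K c z * matP h ^ (r + s) * matY K c y) =
      ρ ^ r • (matZ K c z * matP h ^ r * matTheta ρ h * matY K c y) := by
  simp only [matTheta_eq_sum, Finset.smul_sum, pow_add, mul_smul,
    Matrix.mul_smul, Matrix.smul_mul, Matrix.mul_assoc, Matrix.mul_sum, Matrix.sum_mul]

end Limit

section Reachability

open Relation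

theorem isIrreducible_of_transGen {n R : Type*} [Ring R] [LinearOrder R] {A : Matrix n n R}
    (hA : ∀ i j, 0 ≤ A i j) (h : ∀ i j, TransGen (0 < A · ·) i j) : A.IsIrreducible := by
  let : Quiver n := toQuiver A
  refine ⟨hA, fun i j ↦ ?_⟩
  induction h i j with
  | single hij => exact ⟨Quiver.Hom.toPath ⟨hij⟩, one_pos⟩
  | tail _ hjk ih => exact ⟨ih.choose.cons ⟨hjk⟩, Nat.succ_pos _⟩

variable {n : Type*} [Fintype n] [DecidableEq n]
variable {R : Type*} [Semiring R] [PartialOrder R] [IsStrictOrderedRing R] {M : Matrix n n R}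

theorem mem_of_mem_doublyStochastic (hM : M ∈ doublyStochastic R n) {S : Finset n}
    (hS : ∀ i ∈ S, ∀ j, M i j ≠ 0 → j ∈ S) {i j : n} (hj : j ∈ S) (hij : M i j ≠ 0) : i ∈ S := by
  by_contra hi
  have hrow : ∑ i ∈ S, ∑ j ∈ S, M i j = S.card • 1 := by
    rw [← Finset.sum_const]
    refine Finset.sum_congr rfl fun i hi ↦ ?_
    rw [← sum_row_of_mem_doublyStochastic hM i]
    exact Finset.sum_subset S.subset_univ fun j _ hj ↦ not_not.mp (mt (hS i hi j) hj)
  have hcol : ∑ j ∈ S, ∑ i ∈ S, M i j < S.card • 1 := by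
    rw [← Finset.sum_const]
    refine Finset.sum_lt_sum (fun j _ ↦ ?_) ⟨j, hj, ?_⟩
    · rw [← sum_col_of_mem_doublyStochastic hM j]
      exact Finset.sum_le_univ_sum_of_nonneg fun _ ↦ nonneg_of_mem_doublyStochastic hM
    · rw [← sum_col_of_mem_doublyStochastic hM j]
      exact Finset.sum_lt_sum_of_subset S.subset_univ (Finset.mem_univ i) hi
        ((nonneg_of_mem_doublyStochastic hM).lt_of_ne' hij)
        fun _ _ _ ↦ nonneg_of_mem_doublyStochastic hM
  rw [Finset.sum_comm, hrow] at hcol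
  exact hcol.false

theorem reflTransGen_symm_of_mem_doublyStochastic (hM : M ∈ doublyStochastic R n) {i j : n}
    (h : ReflTransGen (M · · ≠ 0) i j) : ReflTransGen (M · · ≠ 0) j i := by
  classical
  induction h with
  | refl => rfl
  | @tail j k _ hjk ih =>
    have hkj : j ∈ ({x | ReflTransGen (M · · ≠ 0) k x} : Finset n) :=
      mem_of_mem_doublyStochastic hM (by simpa using fun _ h _ ↦ h.tail)
        (by simp [ReflTransGen.refl]) hjk
    exact (by simpa using hkj : ReflTransGen (M · · ≠ 0) k j).trans ih

end Reachability

namespace BipartiteGraph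

open Relation

variable {E L R : Type*} {B : BipartiteGraph E L R}

theorem forall_of_preconnected (hB : B.nodeGraph.Preconnected) {p : E → Prop}
    (hleft : ∀ x y, B.left x = B.left y → p x → p y)
    (hright : ∀ x y, B.right x = B.right y → p x → p y) {a : E} (ha : p a) (x : E) : p x := by
  let q : L ⊕ R → Prop :=
    Sum.elim (fun l ↦ ∀ y, B.left y = l → p y) fun r ↦ ∀ y, B.right y = r → p y
  have hadj (u v) (huv : B.nodeGraph.Adj u v) (hu : q u) : q v := by
    rcases ((SimpleGraph.fromRel_adj _ _ _).mp huv).2 with ⟨y, rfl, rfl⟩ | ⟨y, rfl, rfl⟩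
    · exact fun w hw ↦ hright y w hw.symm (hu y rfl)
    · exact fun w hw ↦ hleft y w hw.symm (hu y rfl)
  have hq (v) : q v := by
    have hreach := (SimpleGraph.reachable_iff_reflTransGen _ _).mp (hB (Sum.inl (B.left a)) v)
    induction hreach with
    | refl => exact fun y hy ↦ hleft a y hy.symm ha
    | tail _ huv ih => exact hadj _ _ huv ih
  exact hq (Sum.inl (B.left x)) x rfl

theorem existsUnique_isConj (hR : ∀ r, B.rightDegree r = 2) (f : E) : ∃! g, B.IsConj f g := by
  obtain ⟨⟨g, hg⟩, hne, huniq⟩ := (Nat.card_eq_two_iff' ⟨f, rfl⟩).mp (hR (B.right f))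
  refine ⟨g, ⟨fun h ↦ hne (Subtype.ext h), hg⟩, fun k hk ↦ ?_⟩
  exact congrArg Subtype.val (huniq ⟨k, hk.2⟩ fun h ↦ hk.1 (congrArg Subtype.val h))

theorem exists_conj (hR : ∀ r, B.rightDegree r = 2) :
    ∃ bar : Equiv.Perm E, Function.Involutive bar ∧ ∀ f g, B.IsConj f g ↔ g = bar f := by
  choose bar hbar huniq using existsUnique_isConj hR
  have hinv : Function.Involutive bar := fun f ↦
    (huniq (bar f) f ⟨(hbar f).1.symm, (hbar f).2.symm⟩).symm
  exact ⟨hinv.toPerm, hinv, fun f g ↦ ⟨huniq f g, fun h ↦ h ▸ hbar f⟩⟩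

section Siblings

variable [Fintype E]

variable (B) in
open Classical in
/-- The edges other than `e` at the left node of `e`: the edges along which a non-backtracking walk
entering this node through `e` can leave it. -/
noncomputable def siblings (e : E) : Finset E := {g | B.left g = B.left e ∧ g ≠ e}

theorem mem_siblings {e g : E} : g ∈ B.siblings e ↔ B.left g = B.left e ∧ g ≠ e := by
  simp [siblings]

theorem mem_siblings_comm {e g : E} : g ∈ B.siblings e ↔ e ∈ B.siblings g := by
  simp only [mem_siblings, eq_comm, ne_comm]

theorem card_siblings_add_one (e : E) :
    (B.siblings e).card + 1 = B.leftDegree (B.left e) := by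
  classical
  have hsiblings : B.siblings e = ({g | B.left g = B.left e} : Finset E).erase e := by
    ext g
    simp [mem_siblings, and_comm]
  rw [hsiblings, Finset.card_erase_add_one (by simp), leftDegree, Nat.card_eq_fintype_card,
    Fintype.card_subtype]

theorem siblings_nonempty (hL : ∀ l, 2 ≤ B.leftDegree l) (e : E) : (B.siblings e).Nonempty := by
  have hdeg := hL (B.left e)
  rw [← card_siblings_add_one] at hdeg
  exact Finset.card_pos.mp (by lia)

theorem exists_one_lt_card_siblings (hL3 : ∃ l, 3 ≤ B.leftDegree l) :
    ∃ a, 1 < (B.siblings a).card := by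
  obtain ⟨l, hl⟩ := hL3
  obtain ⟨⟨a, rfl⟩⟩ := (Nat.card_pos_iff.mp (by lia : 0 < B.leftDegree l)).1
  rw [← card_siblings_add_one] at hl
  exact ⟨a, by lia⟩

variable (B) in
open Classical in
/-- The transition matrix of the random walk on edges that moves from `e` to a uniformly random
sibling of `e`. -/
noncomputable def siblingWalk : Matrix E E ℚ :=
  of fun e g ↦ if g ∈ B.siblings e then ((B.siblings e).card : ℚ)⁻¹ else 0

theorem siblingWalk_apply_ne_zero {e g : E} : B.siblingWalk e g ≠ 0 ↔ g ∈ B.siblings e := by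
  have hcard : g ∈ B.siblings e → (B.siblings e).card ≠ 0 := Finset.card_ne_zero_of_mem
  simpa [siblingWalk] using hcard

open Classical in
theorem transpose_siblingWalk : B.siblingWalkᵀ = B.siblingWalk := by
  ext e g
  refine if_ctx_congr mem_siblings_comm (fun hg ↦ ?_) fun _ ↦ rfl
  have hcard : (B.siblings g).card + 1 = (B.siblings e).card + 1 := by
    rw [card_siblings_add_one, card_siblings_add_one, (mem_siblings.mp hg).1]
  rw [Nat.add_right_cancel hcard]

variable [DecidableEq E]

theorem siblingWalk_mem_doublyStochastic (hL : ∀ l, 2 ≤ B.leftDegree l) :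
    B.siblingWalk ∈ doublyStochastic ℚ E := by
  have hrow (e : E) : ∑ g, B.siblingWalk e g = 1 := by
    have hcard : ((B.siblings e).card : ℚ) ≠ 0 := by
      exact_mod_cast (siblings_nonempty hL e).card_ne_zero
    simp [siblingWalk, hcard]
  refine mem_doublyStochastic_iff_sum.mpr ⟨fun e g ↦ ?_, hrow, fun g ↦ ?_⟩
  · rw [siblingWalk, of_apply]
    positivity
  · rw [← hrow g]
    exact Finset.sum_congr rfl fun e _ ↦ congrFun₂ transpose_siblingWalk g e

end Siblings

section NonBacktracking

variable [Fintype E] {bar : Equiv.Perm E}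

variable (B bar) in
/-- The steps of a non-backtracking walk whose edges are recorded as they enter a left node: the
walk leaves the left node of `e` along a sibling of `e` and turns over at the next right node. -/
def Step (e f : E) : Prop := bar f ∈ B.siblings e

theorem step_bar (hbar : Function.Involutive bar) {e g : E} (hg : g ∈ B.siblings e) :
    B.Step bar e (bar g) := by
  rwa [Step, hbar g]

theorem reflTransGen_step_symm (hL : ∀ l, 2 ≤ B.leftDegree l) {e f : E}
    (h : ReflTransGen (B.Step bar) e f) : ReflTransGen (B.Step bar) f e := by
  classical
  have hM := reindex_mem_doublyStochastic (e₁ := Equiv.refl E) (e₂ := bar.symm)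
    (siblingWalk_mem_doublyStochastic hL)
  have hstep : B.Step bar = (B.siblingWalk.reindex (Equiv.refl E) bar.symm · · ≠ 0) := by
    ext e f
    exact siblingWalk_apply_ne_zero.symm
  rw [hstep] at h ⊢
  exact reflTransGen_symm_of_mem_doublyStochastic hM h

theorem reflTransGen_step_of_mem_siblings (hbar : Function.Involutive bar)
    (hL : ∀ l, 2 ≤ B.leftDegree l) {e g : E} (hg : g ∈ B.siblings e) :
    ReflTransGen (B.Step bar) (bar e) g :=
  reflTransGen_step_symm hL (.single (step_bar hbar (mem_siblings_comm.mp hg)))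

-- Two siblings `g`, `k` of `a` let the walk turn around: it leaves the left node along `g`, comes
-- back to it through `k`, and leaves it along `a`.
theorem reflTransGen_step_bar_of_one_lt_card (hbar : Function.Involutive bar)
    (hL : ∀ l, 2 ≤ B.leftDegree l) {a : E} (ha : 1 < (B.siblings a).card) :
    ReflTransGen (B.Step bar) a (bar a) := by
  obtain ⟨g, hg, k, hk, hgk⟩ := Finset.one_lt_card.mp ha
  have hkg : k ∈ B.siblings g :=
    mem_siblings.mpr ⟨(mem_siblings.mp hk).1.trans (mem_siblings.mp hg).1.symm, hgk.symm⟩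
  have hak : ReflTransGen (B.Step bar) a k :=
    .head (step_bar hbar hg) (reflTransGen_step_of_mem_siblings hbar hL hkg)
  exact hak.tail (step_bar hbar (mem_siblings_comm.mp hk))

theorem reflTransGen_step (hB : B.nodeGraph.Preconnected) (hbar : Function.Involutive bar)
    (hconj : ∀ f g, B.IsConj f g ↔ g = bar f) (hL : ∀ l, 2 ≤ B.leftDegree l)
    (hL3 : ∃ l, 3 ≤ B.leftDegree l) (e f : E) : ReflTransGen (B.Step bar) e f := by
  obtain ⟨a, ha⟩ := exists_one_lt_card_siblings hL3
  have hboth (x : E) : ReflTransGen (B.Step bar) a x ∧ ReflTransGen (B.Step bar) a (bar x) := by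
    refine forall_of_preconnected hB
      (p := fun x ↦ ReflTransGen (B.Step bar) a x ∧ ReflTransGen (B.Step bar) a (bar x))
      (fun x y hxy hx ↦ ?_) (fun x y hxy hx ↦ ?_)
      ⟨.refl, reflTransGen_step_bar_of_one_lt_card hbar hL ha⟩ x
    · rcases eq_or_ne y x with rfl | hne
      · exact hx
      have hy : y ∈ B.siblings x := mem_siblings.mpr ⟨hxy.symm, hne⟩
      exact ⟨hx.2.trans (reflTransGen_step_of_mem_siblings hbar hL hy),
        hx.1.tail (step_bar hbar hy)⟩
    · rcases eq_or_ne y x with rfl | hne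
      · exact hx
      rw [(hconj x y).mp ⟨hne, hxy.symm⟩, hbar x]
      exact hx.symm
  exact (reflTransGen_step_symm hL (hboth e).1).trans (hboth f).1

end NonBacktracking

section FlowMatrix

open Classical in
theorem flowMatrix_apply [Fintype E] {bar : Equiv.Perm E} (hconj : ∀ f g, B.IsConj f g ↔ g = bar f)
    (e f : E) : B.flowMatrix e f = if B.Step bar e f then 1 else 0 := by
  simp [flowMatrix, hconj, Step, mem_siblings]

theorem flowMatrix_isIrreducible [Finite E] (hB : B.nodeGraph.Preconnected)
    (hR : ∀ r, B.rightDegree r = 2) (hL : ∀ l, 2 ≤ B.leftDegree l)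
    (hL3 : ∃ l, 3 ≤ B.leftDegree l) : B.flowMatrix.IsIrreducible := by
  have := Fintype.ofFinite E
  obtain ⟨bar, hbar, hconj⟩ := exists_conj hR
  have hpos : (0 < B.flowMatrix · ·) = B.Step bar := by
    ext e f
    rw [flowMatrix_apply hconj]
    split_ifs with h <;> simp [h]
  refine isIrreducible_of_transGen (fun e f ↦ ?_) fun e f ↦ ?_
  · rw [flowMatrix_apply hconj]
    positivity
  · obtain ⟨g, hg⟩ := siblings_nonempty hL e
    rw [hpos]
    exact .head' (step_bar hbar hg) (reflTransGen_step hB hbar hconj hL hL3 (bar g) f)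

variable [Fintype E]

theorem one_vecMul_flowMatrix {bar : Equiv.Perm E} (hconj : ∀ f g, B.IsConj f g ↔ g = bar f) :
    1 ᵥ* B.flowMatrix = fun f ↦ ((B.siblings (bar f)).card : ℝ) := by
  classical
  ext f
  have hfilter : ({e | B.Step bar e f} : Finset E) = B.siblings (bar f) := by
    ext e
    simp [Step, mem_siblings_comm (g := bar f)]
  simp [vecMul, dotProduct, flowMatrix_apply hconj, hfilter]

theorem one_lt_perronRoot_flowMatrix [DecidableEq E] (hB : B.nodeGraph.Preconnected)
    (hR : ∀ r, B.rightDegree r = 2) (hL : ∀ l, 2 ≤ B.leftDegree l)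
    (hL3 : ∃ l, 3 ≤ B.leftDegree l) : 1 < perronRoot B.flowMatrix := by
  obtain ⟨bar, hbar, hconj⟩ := exists_conj hR
  obtain ⟨a, ha⟩ := exists_one_lt_card_siblings hL3
  refine lt_perronRoot_of_smul_lt_vecMul (flowMatrix_isIrreducible hB hR hL hL3)
    zero_le_one (y := 1) ?_
  rw [one_smul, one_vecMul_flowMatrix hconj]
  refine Pi.lt_def.mpr ⟨fun f ↦ ?_, bar a, ?_⟩
  · exact Nat.one_le_cast.mpr (siblings_nonempty hL (bar f)).card_pos
  · rw [hbar a]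
    exact Nat.one_lt_cast.mpr ha

end FlowMatrix

end BipartiteGraph

end FlowLimit

theorem lemma4p2_general {n : Type*} [Fintype n] [DecidableEq n] {K : Matrix n n ℝ}
    (hK : K.IsIrreducible) (hρ : 1 < FlowLimit.perronRoot K) {h : ℕ}
    (hh : FlowLimit.IsImprimitivityIndex K h) {c : n → Fin h}
    (hc : FlowLimit.IsCyclicPartition K c) {y z : FlowLimit.Cls c 0 → ℝ}
    (hyz : FlowLimit.IsPerronPair (FlowLimit.cycleProd K c) y z) (r : ℕ) :
    Tendsto
      (fun q : ℕ ↦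
        ((FlowLimit.perronRoot K ^ h - 1) / (FlowLimit.perronRoot K ^ (h * q) - 1)) •
          ∑ i ∈ Finset.range (h * q + r), K ^ i)
      atTop
      (𝓝 (FlowLimit.perronRoot K ^ r •
        (FlowLimit.matZ K c z * FlowLimit.matP h ^ r *
          FlowLimit.matTheta (FlowLimit.perronRoot K) h * FlowLimit.matY K c y))) := by
  let : NormedAddCommGroup (Matrix n n ℝ) := Matrix.normedAddCommGroup
  let : NormedSpace ℝ (Matrix n n ℝ) := Matrix.normedSpace
  rw [← FlowLimit.sum_smul_matZ_mul_matP_pow_mul_matY]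
  exact FlowLimit.tendsto_smul_sum_of_residue_classes hρ hh.1.1
    (FlowLimit.tendsto_pow_residue_class hK hh hc hyz) r

theorem lemma4p2 :
    -- the limit formula for an irreducible nonnegative matrix with Perron root greater than `1`
    (∀ {n : Type*} [Fintype n] [DecidableEq n] (K : Matrix n n ℝ),
      K.IsIrreducible → 1 < FlowLimit.perronRoot K →
      ∀ (h : ℕ), FlowLimit.IsImprimitivityIndex K h →
      ∀ (c : n → Fin h), FlowLimit.IsCyclicPartition K c →
      ∀ (y z : FlowLimit.Cls c 0 → ℝ),
        FlowLimit.IsPerronPair (FlowLimit.cycleProd K c) y z →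
      ∀ (r : ℕ), r < h →
        Tendsto
          (fun q : ℕ =>
            ((FlowLimit.perronRoot K ^ h - 1) / (FlowLimit.perronRoot K ^ (h * q) - 1)) •
              ∑ i ∈ Finset.range (h * q + r), K ^ i)
          atTop
          (𝓝 (FlowLimit.perronRoot K ^ r •
            (FlowLimit.matZ K c z * FlowLimit.matP h ^ r *
              FlowLimit.matTheta (FlowLimit.perronRoot K) h * FlowLimit.matY K c y)))) ∧
    -- every flow matrix is such a matrix
    (∀ {E L R : Type*} [Fintype E] [DecidableEq E] (B : FlowLimit.BipartiteGraph E L R),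
      B.nodeGraph.Connected →
      (∀ r : R, B.rightDegree r = 2) →
      (∀ l : L, 2 ≤ B.leftDegree l) →
      (∃ l : L, 3 ≤ B.leftDegree l) →
        B.flowMatrix.IsIrreducible ∧ 1 < FlowLimit.perronRoot B.flowMatrix) := by
  refine ⟨fun K hK hρ h hh c hc y z hyz r _ ↦ lemma4p2_general hK hρ hh hc hyz r,
    fun B hB hR hL hL3 ↦ ⟨?_, ?_⟩⟩
  · exact FlowLimit.BipartiteGraph.flowMatrix_isIrreducible hB.preconnected hR hL hL3
  · exact FlowLimit.BipartiteGraph.one_lt_perronRoot_flowMatrix hB.preconnected hR hL hL3
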